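/- **Definitions.** Let $A$ be a unital $C^*$-algebra with state space $\mathcal S(A)$. A *Lip-norm* on $A$ is a seminorm $L:A\to[0,\infty]$ (with the convention $0\cdot\infty=0$) such that $L(a^*)=L(a)$ for all $a\in A$; $L(a)=0$ if and only if $a\in\mathbb C\mathbf 1_A$; $\mathrm{dom}(L)=\{a\in A:L(a)<\infty\}$ is dense in $A$; and the metric $\rho_L(\mu,\nu)=\sup\{|\mu(a)-\nu(a)|:a\in A,\ L(a)\le 1\}$ on $\mathcal S(A)$ induces the weak$^*$-topology. Then $(A,L)$ is called a *compact quantum metric space*. Compact quantum metric spaces $(A,L_A)$ and $(B,L_B)$ are *Lipschitz isomorphic* if there are a $^*$-isomorphism $e:A\to B$ and constants $\lambda,\gamma>0$ with $L_B(e(a))\le\lambda L_A(a)$ and $L_A(e^{-1}(b))\le\gamma L_B(b)$ for all $a\in A$, $b\in B$. An *inductive sequence of compact quantum metric spaces* $\{((A_n,L_{A_n}),\phi_n)\}_{n\ge1}$ consists of compact quantum metric spaces $(A_n,L_{A_n})$ and unital $^*$-homomorphisms $\phi_n:A_n\to A_{n+1}$ with $\phi_n(\mathrm{dom}(L_{A_n}))\subset\mathrm{dom}(L_{A_{n+1}})$.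 Let $A=\varinjlim(A_n,\phi_n)$ be the $C^*$-algebraic inductive limit, with canonical maps $\phi^n:A_n\to A$. It is equipped with $$L_A(a)=\sup\left\{\frac{|\mu(a)-\nu(a)|}{\rho(\mu,\nu)}:\mu,\nu\in\mathcal S(A),\ \mu\ne\nu\right\},\qquad \rho(\mu,\nu)=\sum_{n=1}^\infty\frac1{2^n}\,\frac{\rho_{L_{A_n}}(\mu\circ\phi^n,\nu\circ\phi^n)}{1+\rho_{L_{A_n}}(\mu\circ\phi^n,\nu\circ\phi^n)} .$$ **Theorem 4.7.** Let $\{((A_n,L_{A_n}),\phi_n)\}$ and $\{((B_n,L_{B_n}),\varphi_n)\}$ be two inductive sequences of compact quantum metric spaces, with limits $A$ and $B$, canonical maps $\phi^n:A_n\to A$ and $\varphi^n:B_n\to B$, and seminorms $L_A$ and $L_B$ on the limits as above. Let $\psi_n:A_n\to B_n$ and $\Psi_n:B_n\to A_{n+1}$ $(n\ge1)$ be unital $^*$-homomorphisms with $\Psi_n\circ\psi_n=\phi_n$ and $\psi_{n+1}\circ\Psi_n=\varphi_n$ for all $n$. Suppose that there are bounded sequences $\{\lambda_n\}$ and $\{\gamma_n\}$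 of non-negative real numbers such that for all $n$ $$L_B(\varphi^n(\psi_n(a)))\le\lambda_nL_{A_n}(a)\quad(a\in A_n),\qquad L_A(\phi^{n+1}(\Psi_n(b)))\le\gamma_nL_{B_n}(b)\quad(b\in B_n).$$ Then there are unital $^*$-homomorphisms $\psi:A\to B$ and $\Psi:B\to A$ such that 1. $\psi\circ\Psi=\mathrm{id}_B$ and $\Psi\circ\psi=\mathrm{id}_A$; 2. for each $n$, $\psi\circ\phi^n=\varphi^n\circ\psi_n$, $\ \Psi\circ\varphi^n=\phi^{n+1}\circ\Psi_n$, $\ \phi^{n+1}\circ\Psi_n\circ\psi_n=\phi^n$ and $\psi\circ\phi^{n+1}\circ\Psi_n=\varphi^n$; 3. $L_B(\psi(a))\le 2\sup_n\lambda_n\cdot L_A(a)$ for all $a\in A$; 4. $L_A(\Psi(b))\le 2\sup_n\gamma_n\cdot L_B(b)$ for all $b\in B$. They are unique: $\psi$ is the only unital $^*$-homomorphism $A\to B$ with $\psi\circ\phi^n=\varphi^n\circ\psi_n$ for all $n$, and $\Psi$ is the only unital $^*$-homomorphism $B\to A$ with $\Psi\circ\varphi^n=\phi^{n+1}\circ\Psi_n$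 for all $n$. Moreover, $(A,L_A)$ and $(B,L_B)$ are compact quantum metric spaces, and they are Lipschitz isomorphic. -/

import Mathlib

open Filter Topology
open scoped ENNReal NNReal ComplexOrder

noncomputable section

namespace QMS

universe u v

section Single

variable {A : Type u} [CStarAlgebra A]

/-- The state space of a unital C⋆-algebra: the positive linear functionals `f` with `f 1 = 1`.
As a subtype of `WeakDual ℂ A` it carries the weak⋆ topology. -/
abbrev StateSpace (A : Type u) [CStarAlgebra A] : Type u :=
  {f : WeakDual ℂ A // f 1 = 1 ∧ ∀ a : A, 0 ≤ f (star a * a)}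

/-- The restriction `μ ↦ μ ∘ f` of states along a unital ⋆-homomorphism `f`. -/
def StateSpace.pullback {B : Type v} [CStarAlgebra B] (f : A →⋆ₐ[ℂ] B) (μ : StateSpace B) :
    StateSpace A :=
  ⟨StrongDual.toWeakDual ((WeakDual.toStrongDual μ.1).comp
      { toLinearMap := f.toAlgHom.toLinearMap
        cont := AddMonoidHomClass.continuous_of_bound f 1 fun a => by
          simpa using NonUnitalStarAlgHom.norm_apply_le f a }), by
    refine ⟨?_, fun a => ?_⟩
    · change μ.1 (f 1) = 1
      rw [map_one, μ.2.1]
    · change 0 ≤ μ.1 (f (star a * a))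
      rw [map_mul, map_star]
      exact μ.2.2 (f a)⟩

theorem StateSpace.pullback_apply {B : Type v} [CStarAlgebra B] (f : A →⋆ₐ[ℂ] B)
    (μ : StateSpace B) (a : A) : (StateSpace.pullback f μ).1 a = μ.1 (f a) := rfl

/-- A Lipschitz seminorm: a seminorm, possibly with the value `∞`, that is invariant under the
involution, vanishes exactly on the scalars, and is finite on a dense set. -/
structure IsLipschitzSeminorm (L : A → ℝ≥0∞) : Prop where
  add_le : ∀ a b, L (a + b) ≤ L a + L b
  smul : ∀ (c : ℂ) (a : A), L (c • a) = ‖c‖ₑ * L a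
  star : ∀ a, L (star a) = L a
  eq_zero_iff : ∀ a, L a = 0 ↔ ∃ c : ℂ, a = algebraMap ℂ A c
  dense : Dense {a | L a < ∞}

/-- The Monge-Kantorovich distance on the state space given by `L`, possibly infinite. -/
def mkDist (L : A → ℝ≥0∞) (μ ν : StateSpace A) : ℝ≥0∞ :=
  ⨆ (a : A) (_ : L a ≤ 1), ‖μ.1 a - ν.1 a‖ₑ

/-- The extended pseudometric structure given by the Monge-Kantorovich distance. -/
@[reducible] def mkPseudoEMetric (L : A → ℝ≥0∞) : PseudoEMetricSpace (StateSpace A) where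
  edist := mkDist L
  edist_self μ := by simp [mkDist]
  edist_comm μ ν := by
    simp only [mkDist]
    refine iSup_congr fun a => iSup_congr fun _ => ?_
    rw [← neg_sub, enorm_neg]
  edist_triangle μ ν τ := by
    simp only [mkDist]
    refine iSup₂_le fun a ha => ?_
    calc ‖μ.1 a - τ.1 a‖ₑ = ‖(μ.1 a - ν.1 a) + (ν.1 a - τ.1 a)‖ₑ := by rw [sub_add_sub_cancel]
      _ ≤ ‖μ.1 a - ν.1 a‖ₑ + ‖ν.1 a - τ.1 a‖ₑ := enorm_add_le _ _
      _ ≤ _ := add_le_add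
        (le_iSup₂ (f := fun (a : A) (_ : L a ≤ 1) => ‖μ.1 a - ν.1 a‖ₑ) a ha)
        (le_iSup₂ (f := fun (a : A) (_ : L a ≤ 1) => ‖ν.1 a - τ.1 a‖ₑ) a ha)

/-- A Lip-norm: a Lipschitz seminorm whose Monge-Kantorovich distance induces the weak⋆ topology
on the state space. The pair `(A, L)` is then a compact quantum metric space. -/
structure IsLipNorm (L : A → ℝ≥0∞) : Prop extends IsLipschitzSeminorm L where
  topology_eq : (mkPseudoEMetric L).toUniformSpace.toTopologicalSpace =
    (inferInstance : TopologicalSpace (StateSpace A))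

/-- Two compact quantum metric spaces are Lipschitz isomorphic. -/
def LipschitzIsomorphic {B : Type v} [CStarAlgebra B] (LA : A → ℝ≥0∞) (LB : B → ℝ≥0∞) : Prop :=
  IsLipNorm LA ∧ IsLipNorm LB ∧
    ∃ (e : A ≃⋆ₐ[ℂ] B) (l c : ℝ≥0), 0 < l ∧ 0 < c ∧
      (∀ a, LB (e a) ≤ l * LA a) ∧ ∀ b, LA (e.symm b) ≤ c * LB b

end Single

section Limit

variable {A : ℕ → Type u} [∀ n, CStarAlgebra (A n)]

/-- The connecting map `A n → A m` for `n ≤ m`, a composition of the given maps. -/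
def conn (φ : ∀ n, A n →⋆ₐ[ℂ] A (n + 1)) {n m : ℕ} (h : n ≤ m) : A n →⋆ₐ[ℂ] A m :=
  Nat.leRec (motive := fun m _ => A n →⋆ₐ[ℂ] A m) (StarAlgHom.id ℂ (A n))
    (fun k _ f => (φ k).comp f) h

theorem conn_self (φ : ∀ n, A n →⋆ₐ[ℂ] A (n + 1)) (n : ℕ) (a : A n) :
    conn φ (le_refl n) a = a := by
  simp [conn, Nat.leRec_self]

theorem conn_succ (φ : ∀ n, A n →⋆ₐ[ℂ] A (n + 1)) {n m : ℕ} (h : n ≤ m) (a : A n) :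
    conn φ (Nat.le_succ_of_le h) a = φ m (conn φ h a) := by
  unfold conn
  rw [Nat.leRec_succ _ _ h]
  rfl

/-- The ⋆-algebra of sequences `x` in the product of the `A n` with `x (n + 1) = φ n (x n)` for
all large `n`. -/
def coherent (φ : ∀ n, A n →⋆ₐ[ℂ] A (n + 1)) : StarSubalgebra ℂ (∀ n, A n) where
  carrier := {x | ∀ᶠ n in atTop, x (n + 1) = φ n (x n)}
  mul_mem' {x y} hx hy := by
    filter_upwards [hx, hy] with n h1 h2
    simp [h1, h2]
  add_mem' {x y} hx hy := by
    filter_upwards [hx, hy] with n h1 h2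
    simp [h1, h2]
  algebraMap_mem' c := Eventually.of_forall fun n => by
    simp only [Pi.algebraMap_apply]
    exact (AlgHomClass.commutes (φ n) c).symm
  star_mem' {x} hx := by
    filter_upwards [hx] with n h
    simp [h, map_star]

/-- A copy of `coherent φ`, to be given the seminorm `‖x‖ = lim ‖x n‖`. -/
def PreLim (φ : ∀ n, A n →⋆ₐ[ℂ] A (n + 1)) : Type u := coherent φ

variable (φ : ∀ n, A n →⋆ₐ[ℂ] A (n + 1))

instance : Ring (PreLim φ) := inferInstanceAs (Ring (coherent φ))
instance : Algebra ℂ (PreLim φ) := inferInstanceAs (Algebra ℂ (coherent φ))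
instance : StarRing (PreLim φ) := inferInstanceAs (StarRing (coherent φ))
instance : StarModule ℂ (PreLim φ) := inferInstanceAs (StarModule ℂ (coherent φ))

/-- The underlying sequence, as a ⋆-homomorphism. -/
def PreLim.val : PreLim φ →⋆ₐ[ℂ] (∀ n, A n) := (coherent φ).subtype

instance : Norm (PreLim φ) := ⟨fun x => limUnder atTop fun n => ‖PreLim.val φ x n‖⟩

theorem PreLim.tendsto_norm (x : PreLim φ) :
    Tendsto (fun n => ‖PreLim.val φ x n‖) atTop (𝓝 ‖x‖) := by
  apply tendsto_nhds_limUnder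
  obtain ⟨N, hN⟩ := eventually_atTop.1 x.2
  have hanti : Antitone fun k => ‖PreLim.val φ x (k + N)‖ := by
    refine antitone_nat_of_succ_le fun k => ?_
    have h : PreLim.val φ x (k + N + 1) = φ (k + N) (PreLim.val φ x (k + N)) :=
      hN (k + N) (Nat.le_add_left _ _)
    rw [Nat.add_right_comm, h]
    exact NonUnitalStarAlgHom.norm_apply_le _ _
  have hbdd : BddBelow (Set.range fun k => ‖PreLim.val φ x (k + N)‖) :=
    ⟨0, by rintro _ ⟨k, rfl⟩; exact norm_nonneg _⟩
  exact ⟨_, (tendsto_add_atTop_iff_nat N).1 (tendsto_atTop_ciInf hanti hbdd)⟩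

theorem PreLim.norm_eq_of_tendsto {x : PreLim φ} {r : ℝ}
    (h : Tendsto (fun n => ‖PreLim.val φ x n‖) atTop (𝓝 r)) : ‖x‖ = r :=
  tendsto_nhds_unique (PreLim.tendsto_norm φ x) h

instance : SeminormedAddCommGroup (PreLim φ) :=
  SeminormedAddCommGroup.ofCore (𝕜 := ℂ)
    { norm_nonneg := fun x => ge_of_tendsto' (PreLim.tendsto_norm φ x) fun _ => norm_nonneg _
      norm_smul := fun c x => PreLim.norm_eq_of_tendsto φ (by
        simpa [norm_smul] using (PreLim.tendsto_norm φ x).const_mul ‖c‖)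
      norm_triangle := fun x y => le_of_tendsto_of_tendsto' (PreLim.tendsto_norm φ (x + y))
        ((PreLim.tendsto_norm φ x).add (PreLim.tendsto_norm φ y)) fun n => by
          simpa using norm_add_le _ _ }

instance : SeminormedRing (PreLim φ) where
  __ : SeminormedAddCommGroup (PreLim φ) := inferInstance
  __ : Ring (PreLim φ) := inferInstance
  norm_mul_le x y := le_of_tendsto_of_tendsto' (PreLim.tendsto_norm φ (x * y))
    ((PreLim.tendsto_norm φ x).mul (PreLim.tendsto_norm φ y)) fun n => by
      simpa using norm_mul_le _ _

instance : NormedAlgebra ℂ (PreLim φ) where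
  norm_smul_le c x := le_of_eq (PreLim.norm_eq_of_tendsto φ (by
    simpa [norm_smul] using (PreLim.tendsto_norm φ x).const_mul ‖c‖))

instance : NormedStarGroup (PreLim φ) where
  norm_star_le x := le_of_eq (PreLim.norm_eq_of_tendsto φ (by
    simpa [map_star] using PreLim.tendsto_norm φ x))

theorem PreLim.norm_mul_self_le (x : PreLim φ) : ‖x‖ * ‖x‖ ≤ ‖star x * x‖ :=
  le_of_tendsto_of_tendsto' ((PreLim.tendsto_norm φ x).mul (PreLim.tendsto_norm φ x))
    (PreLim.tendsto_norm φ (star x * x)) fun n => by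
      simp [map_star, CStarRing.norm_star_mul_self]

theorem PreLim.uniformContinuous_star : UniformContinuous (star : PreLim φ → PreLim φ) :=
  (AddMonoidHomClass.isometry_of_norm (starAddEquiv : PreLim φ ≃+ PreLim φ)
    fun x => norm_star x).uniformContinuous

/-- The inductive limit C⋆-algebra of the sequence `(A n, φ n)`: the Hausdorff completion of the
algebra of eventually coherent sequences for the C⋆-seminorm `lim ‖x n‖`. -/
def IndLim : Type u := UniformSpace.Completion (PreLim φ)

open UniformSpace (Completion)

instance : NormedRing (IndLim φ) := inferInstanceAs (NormedRing (Completion (PreLim φ)))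
instance : CompleteSpace (IndLim φ) := inferInstanceAs (CompleteSpace (Completion (PreLim φ)))
instance : Algebra ℂ (IndLim φ) := inferInstanceAs (Algebra ℂ (Completion (PreLim φ)))

/-- The class in the inductive limit of an eventually coherent sequence. -/
def IndLim.mk (x : PreLim φ) : IndLim φ := (x : Completion (PreLim φ))

theorem IndLim.norm_mk (x : PreLim φ) : ‖IndLim.mk φ x‖ = ‖x‖ := Completion.norm_coe x

theorem IndLim.continuous_mk : Continuous (IndLim.mk φ) := Completion.continuous_coe _

theorem IndLim.denseRange_mk : DenseRange (IndLim.mk φ) := Completion.denseRange_coe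

theorem IndLim.mk_add (x y : PreLim φ) :
    IndLim.mk φ (x + y) = IndLim.mk φ x + IndLim.mk φ y := Completion.coe_add x y

theorem IndLim.mk_sub (x y : PreLim φ) :
    IndLim.mk φ (x - y) = IndLim.mk φ x - IndLim.mk φ y := Completion.coe_sub x y

theorem IndLim.mk_mul (x y : PreLim φ) :
    IndLim.mk φ (x * y) = IndLim.mk φ x * IndLim.mk φ y := Completion.coe_mul x y

theorem IndLim.mk_algebraMap (c : ℂ) :
    IndLim.mk φ (algebraMap ℂ _ c) = algebraMap ℂ _ c := rfl

theorem IndLim.mk_eq_mk_of_eventually {x y : PreLim φ}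
    (h : ∀ᶠ n in atTop, PreLim.val φ x n = PreLim.val φ y n) :
    IndLim.mk φ x = IndLim.mk φ y := by
  rw [← sub_eq_zero, ← IndLim.mk_sub, ← norm_eq_zero, IndLim.norm_mk]
  refine PreLim.norm_eq_of_tendsto φ (Tendsto.congr' ?_ tendsto_const_nhds)
  filter_upwards [h] with n hn
  simp [hn]

instance : Star (IndLim φ) :=
  ⟨(Completion.map star : Completion (PreLim φ) → Completion (PreLim φ))⟩

theorem IndLim.mk_star (x : PreLim φ) : IndLim.mk φ (star x) = star (IndLim.mk φ x) :=
  (Completion.map_coe (PreLim.uniformContinuous_star φ) x).symm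

theorem IndLim.continuous_star : Continuous (star : IndLim φ → IndLim φ) :=
  Completion.continuous_map (f := (star : PreLim φ → PreLim φ))

theorem IndLim.ind {p : IndLim φ → Prop} (hp : IsClosed {x | p x})
    (h : ∀ x, p (IndLim.mk φ x)) (x : IndLim φ) : p x :=
  (IndLim.denseRange_mk φ).induction_on x hp h

theorem IndLim.ind₂ {p : IndLim φ → IndLim φ → Prop}
    (hp : IsClosed {q : IndLim φ × IndLim φ | p q.1 q.2})
    (h : ∀ x y, p (IndLim.mk φ x) (IndLim.mk φ y)) (x y : IndLim φ) : p x y :=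
  (IndLim.denseRange_mk φ).induction_on₂ hp h x y

instance : StarRing (IndLim φ) where
  star_involutive := IndLim.ind φ
    (isClosed_eq ((IndLim.continuous_star φ).comp (IndLim.continuous_star φ)) continuous_id)
    fun x => by rw [← IndLim.mk_star, ← IndLim.mk_star, star_star]
  star_mul := IndLim.ind₂ φ
    (isClosed_eq ((IndLim.continuous_star φ).comp (continuous_fst.mul continuous_snd))
      (((IndLim.continuous_star φ).comp continuous_snd).mul
        ((IndLim.continuous_star φ).comp continuous_fst)))
    fun x y => by
      rw [← IndLim.mk_mul, ← IndLim.mk_star, star_mul, IndLim.mk_mul, IndLim.mk_star,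
        IndLim.mk_star]
  star_add := IndLim.ind₂ φ
    (isClosed_eq ((IndLim.continuous_star φ).comp (continuous_fst.add continuous_snd))
      (((IndLim.continuous_star φ).comp continuous_fst).add
        ((IndLim.continuous_star φ).comp continuous_snd)))
    fun x y => by
      rw [← IndLim.mk_add, ← IndLim.mk_star, star_add, IndLim.mk_add, IndLim.mk_star,
        IndLim.mk_star]

instance : CStarRing (IndLim φ) where
  norm_mul_self_le := IndLim.ind φ
    (isClosed_le (continuous_norm.mul continuous_norm)
      (continuous_norm.comp ((IndLim.continuous_star φ).mul continuous_id)))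
    fun x => by
      rw [← IndLim.mk_star, ← IndLim.mk_mul, IndLim.norm_mk, IndLim.norm_mk]
      exact PreLim.norm_mul_self_le φ x

instance : NormedAlgebra ℂ (IndLim φ) where
  norm_smul_le c := IndLim.ind φ
    (isClosed_le (continuous_norm.comp
      ((continuous_const.mul continuous_id).congr fun x => (Algebra.smul_def c x).symm))
      (continuous_const.mul continuous_norm))
    fun x => by
      rw [Algebra.smul_def, ← IndLim.mk_algebraMap, ← IndLim.mk_mul, ← Algebra.smul_def,
        IndLim.norm_mk, IndLim.norm_mk]
      exact norm_smul_le c x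

instance : StarModule ℂ (IndLim φ) where
  star_smul c x := by
    have h : star (algebraMap ℂ (IndLim φ) c) = algebraMap ℂ (IndLim φ) (star c) := by
      rw [← IndLim.mk_algebraMap, ← IndLim.mk_star, ← algebraMap_star_comm,
        IndLim.mk_algebraMap]
    rw [Algebra.smul_def, star_mul, h, ← Algebra.commutes, ← Algebra.smul_def]

instance : CStarAlgebra (IndLim φ) where

/-- The sequence `(0, …, 0, a, φ n a, φ (n + 1) (φ n a), …)` for `a : A n`. -/
def PreLim.single (n : ℕ) (a : A n) : PreLim φ :=
  ⟨fun k => if h : n ≤ k then conn φ h a else 0, by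
    refine eventually_atTop.2 ⟨n, fun k hk => ?_⟩
    simp only [dif_pos hk, dif_pos (Nat.le_succ_of_le hk), conn_succ φ hk]⟩

theorem PreLim.val_single {n k : ℕ} (h : n ≤ k) (a : A n) :
    PreLim.val φ (PreLim.single φ n a) k = conn φ h a := dif_pos h

/-- The canonical unital ⋆-homomorphism from `A n` to the inductive limit. -/
def toLim (n : ℕ) : A n →⋆ₐ[ℂ] IndLim φ where
  toFun a := IndLim.mk φ (PreLim.single φ n a)
  map_one' := by
    change _ = IndLim.mk φ 1
    refine IndLim.mk_eq_mk_of_eventually φ ?_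
    filter_upwards [eventually_ge_atTop n] with k hk
    simp [PreLim.val_single φ hk]
  map_mul' a b := by
    rw [← IndLim.mk_mul]
    refine IndLim.mk_eq_mk_of_eventually φ ?_
    filter_upwards [eventually_ge_atTop n] with k hk
    simp [PreLim.val_single φ hk]
  map_zero' := by
    change _ = IndLim.mk φ 0
    refine IndLim.mk_eq_mk_of_eventually φ ?_
    filter_upwards [eventually_ge_atTop n] with k hk
    simp [PreLim.val_single φ hk]
  map_add' a b := by
    rw [← IndLim.mk_add]
    refine IndLim.mk_eq_mk_of_eventually φ ?_
    filter_upwards [eventually_ge_atTop n] with k hk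
    simp [PreLim.val_single φ hk]
  commutes' c := by
    rw [← IndLim.mk_algebraMap]
    refine IndLim.mk_eq_mk_of_eventually φ ?_
    filter_upwards [eventually_ge_atTop n] with k hk
    rw [PreLim.val_single φ hk, AlgHomClass.commutes, AlgHomClass.commutes, Pi.algebraMap_apply]
  map_star' a := by
    rw [← IndLim.mk_star]
    refine IndLim.mk_eq_mk_of_eventually φ ?_
    filter_upwards [eventually_ge_atTop n] with k hk
    simp [PreLim.val_single φ hk, map_star]

/-- An inductive sequence of compact quantum metric spaces: every `L n` is a Lip-norm and every
`φ n` maps Lipschitz elements to Lipschitz elements. -/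
structure IsInductiveSequence (L : ∀ n, A n → ℝ≥0∞) : Prop where
  isLipNorm : ∀ n, IsLipNorm (L n)
  map_lipschitz : ∀ n a, L n a < ∞ → L (n + 1) (φ n a) < ∞

/-- The product metric `∑ₙ 2⁻ⁿ dₙ / (1 + dₙ)` on the state space of the inductive limit, where `dₙ`
is the Monge-Kantorovich distance of the restrictions to the `n`-th algebra. The algebras are
numbered from `0`, hence the weight `2⁻⁽ⁿ⁺¹⁾`; each `dₙ` is finite when `L n` is a Lip-norm. -/
def limDist (L : ∀ n, A n → ℝ≥0∞) (μ ν : StateSpace (IndLim φ)) : ℝ≥0∞ :=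
  ∑' n : ℕ, (2 ^ (n + 1))⁻¹ *
    (mkDist (L n) (StateSpace.pullback (toLim φ n) μ) (StateSpace.pullback (toLim φ n) ν) /
      (1 + mkDist (L n) (StateSpace.pullback (toLim φ n) μ)
        (StateSpace.pullback (toLim φ n) ν)))

/-- The seminorm on the inductive limit: the Lipschitz constant of `a`, viewed as a function on
the state space with the product metric. -/
def limLip (L : ∀ n, A n → ℝ≥0∞) (a : IndLim φ) : ℝ≥0∞ :=
  ⨆ (μ : StateSpace (IndLim φ)) (ν : StateSpace (IndLim φ)) (_ : μ ≠ ν),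
    ‖μ.1 a - ν.1 a‖ₑ / limDist φ L μ ν

end Limit

end QMS

end

/-! The homomorphisms come from the universal property of the limit. The families `toLim φ' n ∘ ψ n`
and `toLim φ (n + 1) ∘ Ψ n` are compatible with the connecting maps because the triangles commute.
They therefore extend to the limits (`IndLim.exists_lift`), uniquely by density (`IndLim.hom_ext`),
and the same uniqueness shows that the extensions are mutually inverse.

The Lipschitz estimates come from duality. If `f` sends every `L n`-unit ball into elements of
Lipschitz constant at most `c`, then pulling states back along `f` gives `dₙ ≤ c ρ` for every `n`.
Since `d / (1 + d) ≤ d` and the weights sum to one, pullback is `c`-Lipschitz for the product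
metrics (`limDist_pullback_le`), so `f` increases the Lipschitz constant of an element by a factor
of at most `c`. The argument gives the supremum of the constants, and the factor `2` is slack.

The limit seminorm is a Lip-norm for three reasons. States separate elements, because every spectral
value is attained by a state (`exists_state_apply_eq`), so the seminorm vanishes only on scalars.
Each `dₙ` is bounded, so Lipschitz elements of `A n` remain Lipschitz in the limit, and these are
dense. Finally, the Monge-Kantorovich distance is at most `limDist`, which is weak⋆ continuous, and
a separating distance continuous on the diagonal of a compact space induces its topology. -/

namespace QMS

universe u v

/-! ### States: compactness, existence and separation of elements -/

section States

variable {A : Type u} [CStarAlgebra A]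

/-- A state as a positive linear map. -/
noncomputable def StateSpace.toPositive [PartialOrder A] [StarOrderedRing A] (μ : StateSpace A) :
    A →ₚ[ℂ] ℂ :=
  PositiveLinearMap.mk₀ (WeakDual.toStrongDual μ.1).toLinearMap fun x hx => by
    obtain ⟨b, rfl⟩ := CStarAlgebra.nonneg_iff_eq_star_mul_self.1 hx
    exact μ.2.2 b

theorem StateSpace.apply_star (μ : StateSpace A) (a : A) : μ.1 (star a) = star (μ.1 a) := by
  let _ := CStarAlgebra.spectralOrder A
  have := CStarAlgebra.spectralOrderedRing A
  exact map_star μ.toPositive a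

theorem StateSpace.apply_algebraMap (μ : StateSpace A) (c : ℂ) :
    μ.1 (algebraMap ℂ A c) = c := by
  rw [Algebra.algebraMap_eq_smul_one, map_smul, μ.2.1, smul_eq_mul, mul_one]

/-- Cauchy-Schwarz in the pre-GNS space of `μ`: `μ a` is the inner product of the vectors of `1` and
`a`, whose norms are `1` and at most `‖a‖`. -/
theorem StateSpace.norm_apply_le (μ : StateSpace A) (a : A) : ‖μ.1 a‖ ≤ ‖a‖ := by
  let _ := CStarAlgebra.spectralOrder A
  have := CStarAlgebra.spectralOrderedRing A
  let f := μ.toPositive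
  have f_apply (x : A) : f x = μ.1 x := rfl
  have norm_toPreGNS (x : A) : ‖f.toPreGNS x‖ = √(μ.1 (star x * x)).re := f.preGNS_norm_def _
  have h1 : μ.1 a = inner ℂ (f.toPreGNS 1) (f.toPreGNS a) := by
    rw [f.preGNS_inner_def]
    simp [f_apply]
  have h2 : ‖f.toPreGNS (1 : A)‖ = 1 := by
    rw [norm_toPreGNS]
    simp [μ.2.1]
  have h3 : ‖f.toPreGNS a‖ ≤ ‖a‖ := by
    rw [norm_toPreGNS]
    refine Real.sqrt_le_iff.2 ⟨norm_nonneg _, ?_⟩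
    calc (μ.1 (star a * a)).re ≤ ‖f (star a * a)‖ := Complex.re_le_norm _
      _ ≤ ‖f 1‖ * ‖star a * a‖ := f.norm_apply_le_of_nonneg _ (star_mul_self_nonneg a)
      _ = ‖a‖ ^ 2 := by
        rw [f_apply, μ.2.1, CStarRing.norm_star_mul_self, norm_one, one_mul, sq]
  calc ‖μ.1 a‖ ≤ ‖f.toPreGNS (1 : A)‖ * ‖f.toPreGNS a‖ := h1 ▸ norm_inner_le_norm _ _
    _ ≤ ‖a‖ := by rw [h2, one_mul]; exact h3

theorem StateSpace.continuous_eval (a : A) : Continuous fun μ : StateSpace A => μ.1 a :=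
  (WeakDual.eval_continuous a).comp continuous_subtype_val

theorem StateSpace.continuous_pullback {B : Type v} [CStarAlgebra B] (f : A →⋆ₐ[ℂ] B) :
    Continuous (StateSpace.pullback f) :=
  Continuous.subtype_mk
    (WeakDual.continuous_of_continuous_eval fun a => StateSpace.continuous_eval (f a)) _

theorem StateSpace.ext {μ ν : StateSpace A} (h : ∀ a, μ.1 a = ν.1 a) : μ = ν :=
  Subtype.ext (DFunLike.ext _ _ h)

theorem StateSpace.eq_of_dense {s : Set A} (hs : Dense s) {μ ν : StateSpace A}
    (h : ∀ a ∈ s, μ.1 a = ν.1 a) : μ = ν :=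
  Subtype.ext (DFunLike.coe_injective
    (Continuous.ext_on hs (map_continuous μ.1) (map_continuous ν.1) h))

/-- Banach-Alaoglu: states form a weak⋆ closed subset of the dual unit ball. -/
instance StateSpace.compactSpace : CompactSpace (StateSpace A) := by
  refine isCompact_iff_compactSpace.1 ?_
  refine (WeakDual.isCompact_closedBall (0 : StrongDual ℂ A) 1).of_isClosed_subset ?_ ?_
  · refine IsClosed.inter (isClosed_eq (WeakDual.eval_continuous 1) continuous_const) ?_
    change IsClosed {f : WeakDual ℂ A | ∀ a : A, 0 ≤ f (star a * a)}
    simp only [Set.ofPred_forall]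
    exact isClosed_iInter fun a => isClosed_le continuous_const (WeakDual.eval_continuous _)
  · intro f hf
    rw [Set.mem_preimage, mem_closedBall_zero_iff]
    refine ContinuousLinearMap.opNorm_le_bound _ zero_le_one fun a => ?_
    rw [one_mul]
    exact StateSpace.norm_apply_le ⟨f, hf⟩ a

/-- A functional of norm at most one with `g 1 = 1` takes real values on self-adjoint elements. -/
theorem im_apply_eq_zero_of_norm_le_one (g : StrongDual ℂ A) (hg : ‖g‖ ≤ 1) (h1 : g 1 = 1)
    {p : A} (hp : IsSelfAdjoint p) : (g p).im = 0 := by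
  have : Nontrivial A := ⟨⟨1, 0, fun h => by simp [h] at h1⟩⟩
  -- Test `g` on `p + i t`: the C⋆-identity bounds its squared norm by `‖p‖² + t²`, whereas `|g (p +
  -- i t)|²` contains the cross term `2 t Im (g p)`.
  have key (t : ℝ) : (g p).re ^ 2 + ((g p).im + t) ^ 2 ≤ ‖p‖ ^ 2 + t ^ 2 := by
    let z : A := p + algebraMap ℂ A (Complex.I * t)
    have hz : g z = g p + Complex.I * t := by
      simp only [z, map_add, Algebra.algebraMap_eq_smul_one, map_smul, h1, smul_eq_mul, mul_one]
    have hs : star z * z = p * p + algebraMap ℂ A ((t ^ 2 : ℝ) : ℂ) := by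
      have e : star z = p - algebraMap ℂ A (Complex.I * t) := by
        simp only [z, star_add, hp.star_eq, ← algebraMap_star_comm]
        rw [sub_eq_add_neg, ← map_neg]
        congr 2
        simp
      rw [e, sub_mul, mul_add, mul_add, ← Algebra.commutes, ← map_mul]
      have : ((t ^ 2 : ℝ) : ℂ) = -(Complex.I * t * (Complex.I * t)) := by
        linear_combination (t : ℂ) ^ 2 * Complex.I_sq + (by push_cast; ring :
          ((t ^ 2 : ℝ) : ℂ) = (t : ℂ) ^ 2)
      rw [this, map_neg]
      abel
    have hn : ‖z‖ ^ 2 ≤ ‖p‖ ^ 2 + t ^ 2 := by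
      rw [sq, ← CStarRing.norm_star_mul_self, hs]
      refine (norm_add_le _ _).trans (add_le_add ?_ ?_)
      · rw [sq]
        exact norm_mul_le _ _
      · rw [norm_algebraMap', Complex.norm_real, Real.norm_of_nonneg (sq_nonneg t)]
    have hgz : ‖g z‖ ^ 2 ≤ ‖z‖ ^ 2 := by
      gcongr
      exact (g.le_opNorm z).trans (mul_le_of_le_one_left (norm_nonneg _) hg)
    have hval : ‖g z‖ ^ 2 = (g p).re ^ 2 + ((g p).im + t) ^ 2 := by
      rw [hz, Complex.sq_norm, Complex.normSq_apply]
      simp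
      ring
    linarith
  by_contra hne
  -- With this `t` the cross term equals `‖p‖² + 1`, which exceeds the bound.
  have h := key ((‖p‖ ^ 2 + 1) / (2 * (g p).im))
  have e : 2 * (g p).im * ((‖p‖ ^ 2 + 1) / (2 * (g p).im)) = ‖p‖ ^ 2 + 1 := by field_simp
  nlinarith [sq_nonneg (g p).re, sq_nonneg (g p).im]

/-- A functional of norm at most one with `g 1 = 1` is positive. -/
theorem apply_star_mul_self_nonneg_of_norm_le_one (g : StrongDual ℂ A) (hg : ‖g‖ ≤ 1)
    (h1 : g 1 = 1) (a : A) : 0 ≤ g (star a * a) := by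
  let _ := CStarAlgebra.spectralOrder A
  have := CStarAlgebra.spectralOrderedRing A
  have : Nontrivial A := ⟨⟨1, 0, fun h => by simp [h] at h1⟩⟩
  set p := star a * a
  have hp : 0 ≤ p := star_mul_self_nonneg a
  have hsa : IsSelfAdjoint p := IsSelfAdjoint.star_mul_self a
  have hle : p ≤ algebraMap ℝ A ‖p‖ := hsa.le_algebraMap_norm_self
  -- As `0 ≤ p ≤ ‖p‖`, the value `g p` lies within `‖p‖` of `‖p‖`, which forces its real part to be
  -- nonnegative.
  have hnorm : ‖algebraMap ℝ A ‖p‖ - p‖ ≤ ‖p‖ := by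
    refine (CStarAlgebra.norm_le_norm_of_nonneg_of_le (sub_nonneg.2 hle)
      (sub_le_self _ hp)).trans ?_
    rw [norm_algebraMap', norm_norm]
  have hval : g (algebraMap ℝ A ‖p‖ - p) = ‖p‖ - g p := by
    rw [map_sub, IsScalarTower.algebraMap_apply ℝ ℂ A, Algebra.algebraMap_eq_smul_one, map_smul,
      h1, smul_eq_mul, mul_one]
    rfl
  have hb : ‖(‖p‖ : ℂ) - g p‖ ≤ ‖p‖ := by
    rw [← hval]
    exact ((g.le_opNorm _).trans (mul_le_of_le_one_left (norm_nonneg _) hg)).trans hnorm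
  have hre := (Complex.re_le_norm _).trans hb
  rw [Complex.sub_re, Complex.ofReal_re] at hre
  exact Complex.nonneg_iff.2
    ⟨by linarith, (im_apply_eq_zero_of_norm_le_one g hg h1 hsa).symm⟩

/-- Every spectral value of an element is the value of some state at it. -/
theorem exists_state_apply_eq {h : A} {c : ℂ} (hc : c ∈ spectrum ℂ h) :
    ∃ μ : StateSpace A, μ.1 h = c := by
  have : Nontrivial A := by
    by_contra hn
    rw [not_nontrivial_iff_subsingleton] at hn
    rw [spectrum.of_subsingleton] at hc
    exact hc
  let k : A := h - algebraMap ℂ A c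
  let S : Submodule ℂ A := ℂ ∙ k
  have hk0 : (0 : ℂ) ∈ spectrum ℂ k := by
    have := spectrum.sub_singleton_eq h c
    rw [← this]
    exact ⟨c, hc, c, rfl, sub_self c⟩
  -- `k` is not invertible, so `1` lies in the spectrum of `1 + b k`. Hence `1` is at distance at
  -- least one from the line spanned by `k`.
  have hone (b : ℂ) : 1 ≤ ‖1 + b • k‖ := by
    have hmem : (1 : ℂ) ∈ spectrum ℂ (1 + b • k) := by
      have h0 : (0 : ℂ) ∈ spectrum ℂ (b • k) := by
        rw [spectrum.zero_mem_iff] at hk0 ⊢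
        intro hu
        rcases eq_or_ne b 0 with rfl | hb
        · simp at hu
        · exact hk0 ((isUnit_smul_iff (Units.mk0 b hb) k).1 hu)
      have := spectrum.singleton_add_eq (b • k) (1 : ℂ)
      rw [map_one] at this
      rw [← this]
      exact ⟨1, rfl, 0, h0, add_zero 1⟩
    simpa using spectrum.norm_le_norm_of_mem hmem
  have hn1 : ‖(S.mkQ 1 : A ⧸ S)‖ = 1 := by
    refine le_antisymm ((Submodule.Quotient.norm_mk_le S 1).trans_eq norm_one) ?_
    refine QuotientAddGroup.le_norm_iff.2 fun m hm => ?_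
    have : m - 1 ∈ S := (Submodule.Quotient.eq S).1 hm
    obtain ⟨b, hb⟩ := Submodule.mem_span_singleton.1 this
    have := hone b
    rwa [hb, add_sub_cancel] at this
  -- Hahn-Banach in the quotient by `k` gives a functional of norm at most one that takes `1` to `1`
  -- and kills `k`; such a functional is a state.
  obtain ⟨q, hq, hq1⟩ := exists_dual_vector'' ℂ (S.mkQ 1 : A ⧸ S)
  rw [hn1] at hq1
  let g : StrongDual ℂ A := (q.toLinearMap ∘ₗ S.mkQ).mkContinuous 1 fun a => by
    rw [one_mul]
    exact (q.le_opNorm _).trans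
      ((mul_le_of_le_one_left (norm_nonneg _) hq).trans (Submodule.Quotient.norm_mk_le S a))
  have hg : ‖g‖ ≤ 1 := LinearMap.mkContinuous_norm_le _ zero_le_one _
  have hg1 : g 1 = 1 := by
    change q (S.mkQ 1) = 1
    rw [hq1]
    simp
  refine ⟨⟨StrongDual.toWeakDual g, hg1, apply_star_mul_self_nonneg_of_norm_le_one g hg hg1⟩, ?_⟩
  have hgk : g k = 0 := by
    change q (S.mkQ k) = 0
    rw [S.mkQ_apply, (Submodule.Quotient.mk_eq_zero S).2 (Submodule.mem_span_singleton_self k),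
      map_zero]
  change g h = c
  have : h = k + algebraMap ℂ A c := (sub_add_cancel _ _).symm
  rw [this, map_add, hgk, zero_add, Algebra.algebraMap_eq_smul_one, map_smul, hg1, smul_eq_mul,
    mul_one]

theorem StateSpace.nonempty [Nontrivial A] : Nonempty (StateSpace A) := by
  obtain ⟨c, hc⟩ := spectrum.nonempty (0 : A)
  exact ⟨(exists_state_apply_eq hc).choose⟩

theorem eq_zero_of_isSelfAdjoint_of_states {h : A} (hh : IsSelfAdjoint h)
    (h0 : ∀ μ : StateSpace A, μ.1 h = 0) : h = 0 :=
  CFC.eq_zero_of_spectrum_subset_zero (R := ℂ) h (fun c hc => by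
    obtain ⟨μ, rfl⟩ := exists_state_apply_eq hc
    exact h0 μ) hh.isStarNormal

/-- The states of a C⋆-algebra separate its elements from zero. -/
theorem eq_zero_of_states {a : A} (h0 : ∀ μ : StateSpace A, μ.1 a = 0) : a = 0 := by
  rw [← realPart_add_I_smul_imaginaryPart a,
    eq_zero_of_isSelfAdjoint_of_states (realPart a).2 fun μ => ?_,
    eq_zero_of_isSelfAdjoint_of_states (imaginaryPart a).2 fun μ => ?_, smul_zero, add_zero]
  · rw [imaginaryPart_apply_coe, map_smul, ← Complex.coe_smul, map_smul, map_sub, μ.apply_star,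
      h0]
    simp
  · rw [realPart_apply_coe, ← Complex.coe_smul, map_smul, map_add, μ.apply_star, h0]
    simp

/-- An element on which all states agree is a scalar. -/
theorem exists_eq_algebraMap_of_states {a : A} (h : ∀ μ ν : StateSpace A, μ.1 a = ν.1 a) :
    ∃ c : ℂ, a = algebraMap ℂ A c := by
  cases subsingleton_or_nontrivial A with
  | inl _ => exact ⟨0, Subsingleton.elim _ _⟩
  | inr _ =>
    obtain ⟨μ₀⟩ := StateSpace.nonempty (A := A)
    refine ⟨μ₀.1 a, sub_eq_zero.1 (eq_zero_of_states fun μ => ?_)⟩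
    rw [map_sub, μ.apply_algebraMap, h μ μ₀, sub_self]

end States

/-! ### Distances inducing a compact topology -/

section Topology

theorem continuous_edist_of_topology_eq {X : Type u} [t : TopologicalSpace X]
    (m : PseudoEMetricSpace X) (h : m.toUniformSpace.toTopologicalSpace = t) :
    Continuous (Function.uncurry m.edist) := by
  subst h
  exact continuous_edist

/-- An extended pseudometric on a compact space that is separating and continuous on the
diagonal for the topology of the space induces this topology. -/
theorem topology_eq_of_tendsto_edist {X : Type u} [t : TopologicalSpace X] [CompactSpace X]
    (m : PseudoEMetricSpace X) (hm : ∀ x y, m.edist x y = 0 → x = y)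
    (hc : ∀ x, Tendsto (fun y => m.edist x y) (𝓝 x) (𝓝 0)) :
    m.toUniformSpace.toTopologicalSpace = t := by
  have ht2 : @T2Space X m.toUniformSpace.toTopologicalSpace :=
    let e : EMetricSpace X := @EMetricSpace.mk X m fun {x y} => hm x y
    @TopologicalSpace.t2Space_of_metrizableSpace X m.toUniformSpace.toTopologicalSpace
      (@EMetricSpace.metrizableSpace X e)
  have hid : @Continuous X X t m.toUniformSpace.toTopologicalSpace id := by
    refine (@continuous_iff_continuousAt X X t m.toUniformSpace.toTopologicalSpace id).2
      fun x => ?_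
    refine (@EMetric.tendsto_nhds X X m _ _ _).2 fun ε hε => ?_
    filter_upwards [(hc x).eventually_lt_const hε] with y hy
    exact (m.edist_comm y x).trans_lt hy
  -- A continuous map from a compact space to a Hausdorff space is closed, so the identity is a
  -- homeomorphism.
  have hclosed := @Continuous.isClosedMap X X t m.toUniformSpace.toTopologicalSpace _ ht2 _ hid
  refine le_antisymm ?_ (continuous_id_iff_le.1 hid)
  refine TopologicalSpace.le_def.2 fun s hs => ?_
  have := hclosed _ (isClosed_compl_iff.2 hs)
  rw [Set.image_id] at this
  exact (@isClosed_compl_iff X m.toUniformSpace.toTopologicalSpace s).1 this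

theorem continuous_comp_uncurry {W X Y : Type*} [TopologicalSpace W] [TopologicalSpace X]
    [TopologicalSpace Y] {F : X → X → Y} (hF : Continuous (Function.uncurry F)) {f g : W → X}
    (hf : Continuous f) (hg : Continuous g) : Continuous fun w => F (f w) (g w) :=
  hF.comp (hf.prodMk hg)

end Topology

/-! ### The Monge-Kantorovich distance and Lip-norms -/

section MongeKantorovich

variable {A : Type u} [CStarAlgebra A]

theorem enorm_sub_le_mkDist {L : A → ℝ≥0∞} {a : A} (ha : L a ≤ 1) (μ ν : StateSpace A) :
    ‖μ.1 a - ν.1 a‖ₑ ≤ mkDist L μ ν :=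
  le_iSup₂ (f := fun (a : A) (_ : L a ≤ 1) => ‖μ.1 a - ν.1 a‖ₑ) a ha

theorem mkDist_self (L : A → ℝ≥0∞) (μ : StateSpace A) : mkDist L μ μ = 0 :=
  (mkPseudoEMetric L).edist_self μ

theorem IsLipschitzSeminorm.enorm_sub_le {L : A → ℝ≥0∞} (hL : IsLipschitzSeminorm L) {a : A}
    (ha : L a < ∞) (μ ν : StateSpace A) :
    ‖μ.1 a - ν.1 a‖ₑ ≤ L a * mkDist L μ ν := by
  rcases eq_or_ne (L a) 0 with h0 | h0
  -- Rescaling `a` to `L a = 1` is impossible here, but `a` is a scalar and all states agree on it.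
  · obtain ⟨c, rfl⟩ := (hL.eq_zero_iff a).1 h0
    simp [StateSpace.apply_algebraMap]
  · lift L a to ℝ≥0 using ha.ne with l hl
    have hl0 : l ≠ 0 := by simpa using h0
    have he : ‖((l⁻¹ : ℝ≥0) : ℂ)‖ₑ = (l : ℝ≥0∞)⁻¹ := by
      rw [← ENNReal.coe_inv hl0, enorm_eq_nnnorm]
      simp
    have h1 : L (((l⁻¹ : ℝ≥0) : ℂ) • a) ≤ 1 := by
      rw [hL.smul, he, ← hl, ENNReal.inv_mul_cancel h0 ENNReal.coe_ne_top]
    have h2 := enorm_sub_le_mkDist h1 μ ν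
    rw [map_smul, map_smul, ← smul_sub, enorm_smul, he] at h2
    rwa [← ENNReal.div_eq_inv_mul, ENNReal.div_le_iff h0 ENNReal.coe_ne_top, mul_comm] at h2

theorem IsLipschitzSeminorm.eq_of_mkDist_eq_zero {L : A → ℝ≥0∞} (hL : IsLipschitzSeminorm L)
    {μ ν : StateSpace A} (h : mkDist L μ ν = 0) : μ = ν :=
  StateSpace.eq_of_dense hL.dense fun a ha => by
    have := hL.enorm_sub_le ha μ ν
    rwa [h, mul_zero, nonpos_iff_eq_zero, enorm_eq_zero, sub_eq_zero] at this

/-- The convex combination `(1 - t) μ + t ν` of two states. -/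
noncomputable def StateSpace.mix (μ ν : StateSpace A) (t : Set.Icc (0 : ℝ) 1) : StateSpace A :=
  ⟨((1 - t.1 : ℝ) : ℂ) • μ.1 + ((t.1 : ℝ) : ℂ) • ν.1, by
    refine ⟨?_, fun a => ?_⟩
    · change ((1 - t.1 : ℝ) : ℂ) * μ.1 1 + ((t.1 : ℝ) : ℂ) * ν.1 1 = 1
      rw [μ.2.1, ν.2.1]
      simp
    · change 0 ≤ ((1 - t.1 : ℝ) : ℂ) * μ.1 (star a * a) + ((t.1 : ℝ) : ℂ) * ν.1 (star a * a)
      exact add_nonneg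
        (mul_nonneg (Complex.zero_le_real.2 (sub_nonneg.2 t.2.2)) (μ.2.2 a))
        (mul_nonneg (Complex.zero_le_real.2 t.2.1) (ν.2.2 a))⟩

theorem StateSpace.mix_apply (μ ν : StateSpace A) (t : Set.Icc (0 : ℝ) 1) (a : A) :
    (StateSpace.mix μ ν t).1 a = ((1 - t.1 : ℝ) : ℂ) * μ.1 a + ((t.1 : ℝ) : ℂ) * ν.1 a := rfl

theorem StateSpace.mix_zero (μ ν : StateSpace A) : StateSpace.mix μ ν 0 = μ :=
  StateSpace.ext fun a => by simp [StateSpace.mix_apply]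

theorem StateSpace.continuous_mix (μ ν : StateSpace A) : Continuous (StateSpace.mix μ ν) := by
  refine Continuous.subtype_mk (WeakDual.continuous_of_continuous_eval fun a => ?_) _
  change Continuous fun t : Set.Icc (0 : ℝ) 1 =>
    ((1 - t.1 : ℝ) : ℂ) * μ.1 a + ((t.1 : ℝ) : ℂ) * ν.1 a
  fun_prop

theorem mkDist_mix (L : A → ℝ≥0∞) (μ ν : StateSpace A) (t : Set.Icc (0 : ℝ) 1) :
    mkDist L μ (StateSpace.mix μ ν t) = ‖(t.1 : ℂ)‖ₑ * mkDist L μ ν := by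
  simp only [mkDist, ENNReal.mul_iSup]
  refine iSup_congr fun a => iSup_congr fun _ => ?_
  rw [← enorm_mul, StateSpace.mix_apply]
  congr 1
  push_cast
  ring

namespace IsLipNorm

variable {L : A → ℝ≥0∞} (hL : IsLipNorm L)

include hL

theorem continuous_mkDist : Continuous (Function.uncurry (mkDist L)) :=
  continuous_edist_of_topology_eq (mkPseudoEMetric L) hL.topology_eq

/-- Continuity at `μ` rules out an infinite distance to `ν`: by `mkDist_mix` every point of the
segment towards `ν` other than `μ` would be infinitely far from `μ`. -/
theorem mkDist_ne_top (μ ν : StateSpace A) : mkDist L μ ν ≠ ∞ := by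
  intro htop
  have hc : Continuous fun t : Set.Icc (0 : ℝ) 1 => mkDist L μ (StateSpace.mix μ ν t) :=
    continuous_comp_uncurry hL.continuous_mkDist continuous_const (StateSpace.continuous_mix μ ν)
  have h0 : mkDist L μ (StateSpace.mix μ ν 0) < 1 := by
    rw [StateSpace.mix_zero, mkDist_self]
    exact zero_lt_one
  obtain ⟨ε, hε, hball⟩ := Metric.eventually_nhds_iff.1 (hc.continuousAt.eventually_lt_const h0)
  have hpos : 0 < min (ε / 2) 1 := lt_min (half_pos hε) one_pos
  have hlt := hball (y := ⟨min (ε / 2) 1, hpos.le, min_le_right _ _⟩) (by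
    rw [Subtype.dist_eq]
    change dist (min (ε / 2) 1) 0 < ε
    rw [Real.dist_0_eq_abs, abs_of_pos hpos]
    exact (min_le_left _ _).trans_lt (half_lt_self hε))
  rw [mkDist_mix, htop, ENNReal.mul_top] at hlt
  · exact not_top_lt hlt
  · rw [Ne, enorm_eq_zero, Complex.ofReal_eq_zero]
    exact hpos.ne'

/-- A continuous finite-valued distance attains its maximum on a compact space. -/
theorem exists_mkDist_le : ∃ D : ℝ≥0, ∀ μ ν, mkDist L μ ν ≤ D := by
  cases isEmpty_or_nonempty (StateSpace A) with
  | inl _ => exact ⟨0, fun μ => isEmptyElim μ⟩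
  | inr _ =>
    obtain ⟨p, -, hp⟩ := isCompact_univ.exists_isMaxOn Set.univ_nonempty
      hL.continuous_mkDist.continuousOn
    refine ⟨(Function.uncurry (mkDist L) p).toNNReal, fun μ ν => ?_⟩
    exact (isMaxOn_univ_iff.1 hp (μ, ν)).trans_eq
      (ENNReal.coe_toNNReal (hL.mkDist_ne_top p.1 p.2)).symm

end IsLipNorm

/-- A Lipschitz seminorm is a Lip-norm as soon as its Monge-Kantorovich distance is weak⋆
continuous on the diagonal. -/
theorem IsLipschitzSeminorm.isLipNorm {L : A → ℝ≥0∞} (hL : IsLipschitzSeminorm L)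
    (hc : ∀ μ, Tendsto (fun ν => mkDist L μ ν) (𝓝 μ) (𝓝 0)) : IsLipNorm L := by
  exact ⟨hL, topology_eq_of_tendsto_edist (mkPseudoEMetric L)
    (fun _ _ => hL.eq_of_mkDist_eq_zero) hc⟩

end MongeKantorovich

/-! ### The product metric and the seminorm on the inductive limit -/

section Limit

variable {A : ℕ → Type u} [∀ n, CStarAlgebra (A n)] (φ : ∀ n, A n →⋆ₐ[ℂ] A (n + 1))

theorem toLim_succ (n : ℕ) (a : A n) : toLim φ (n + 1) (φ n a) = toLim φ n a := by
  refine IndLim.mk_eq_mk_of_eventually φ ?_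
  filter_upwards [eventually_ge_atTop (n + 1)] with k hk
  rw [PreLim.val_single φ hk, PreLim.val_single φ (Nat.le_of_succ_le hk)]
  induction k, hk using Nat.le_induction with
  | base => rw [conn_self, conn_succ φ (le_refl n), conn_self]
  | succ k hk ih => rw [conn_succ φ hk, conn_succ φ (Nat.le_of_succ_le hk), ih]

/-- Every eventually coherent sequence represents the image of any of its late entries. -/
theorem eventually_mk_eq_toLim (x : PreLim φ) :
    ∀ᶠ n in atTop, IndLim.mk φ x = toLim φ n (PreLim.val φ x n) := by
  obtain ⟨N, hN⟩ := eventually_atTop.1 x.2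
  filter_upwards [eventually_ge_atTop N] with n hn
  refine IndLim.mk_eq_mk_of_eventually φ ?_
  filter_upwards [eventually_ge_atTop n] with k hk
  rw [PreLim.val_single φ hk]
  induction k, hk using Nat.le_induction with
  | base => rw [conn_self]
  | succ k hk ih =>
    rw [conn_succ φ hk, ← ih]
    exact hN k (hn.trans hk)

theorem dense_iUnion_range_toLim : Dense (⋃ n, Set.range (toLim φ n)) := by
  refine (IndLim.denseRange_mk φ).mono ?_
  rintro _ ⟨x, rfl⟩
  obtain ⟨n, hn⟩ := (eventually_mk_eq_toLim φ x).exists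
  exact Set.mem_iUnion.2 ⟨n, _, hn.symm⟩

variable (L : ∀ n, A n → ℝ≥0∞)

theorem limDist_term_le (n : ℕ) (d : ℝ≥0∞) :
    (2 ^ (n + 1))⁻¹ * (d / (1 + d)) ≤ (2 ^ (n + 1))⁻¹ :=
  mul_le_of_le_one_right' (ENNReal.div_le_of_le_mul (by rw [one_mul]; exact le_add_self))

theorem tsum_inv_two_pow_succ : ∑' n : ℕ, (2 ^ (n + 1) : ℝ≥0∞)⁻¹ = 1 := by
  simp only [ENNReal.inv_pow]
  rw [ENNReal.tsum_geometric_add_one, ENNReal.one_sub_inv_two, inv_inv,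
    ENNReal.inv_mul_cancel two_ne_zero ENNReal.ofNat_ne_top]

theorem limDist_le_one (μ ν : StateSpace (IndLim φ)) : limDist φ L μ ν ≤ 1 :=
  (ENNReal.tsum_le_tsum fun n => limDist_term_le n _).trans_eq tsum_inv_two_pow_succ

theorem limDist_self (μ : StateSpace (IndLim φ)) : limDist φ L μ μ = 0 := by
  simp [limDist, mkDist_self]

theorem limDist_ne_top (μ ν : StateSpace (IndLim φ)) : limDist φ L μ ν ≠ ∞ :=
  ((limDist_le_one φ L μ ν).trans_lt ENNReal.one_lt_top).ne

variable {φ L} (h : IsInductiveSequence φ L)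

include h

theorem IsInductiveSequence.eq_of_limDist_eq_zero {μ ν : StateSpace (IndLim φ)}
    (h0 : limDist φ L μ ν = 0) : μ = ν := by
  refine StateSpace.eq_of_dense (dense_iUnion_range_toLim φ) fun a ha => ?_
  obtain ⟨n, b, rfl⟩ := Set.mem_iUnion.1 ha
  have hn := ENNReal.tsum_eq_zero.1 h0 n
  rw [mul_eq_zero, ENNReal.div_eq_zero_iff] at hn
  have : mkDist (L n) (StateSpace.pullback (toLim φ n) μ)
      (StateSpace.pullback (toLim φ n) ν) = 0 := by
    rcases hn with hn | hn | hn
    -- A term can vanish only if its weight or `d` is zero, or its denominator is infinite;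
    -- finiteness of `d` excludes the last case.
    · exact absurd hn (ENNReal.inv_ne_zero.2 (ENNReal.pow_ne_top ENNReal.ofNat_ne_top))
    · exact hn
    · exact absurd hn
        (ENNReal.add_ne_top.2 ⟨ENNReal.one_ne_top, (h.isLipNorm n).mkDist_ne_top _ _⟩)
  have := (h.isLipNorm n).eq_of_mkDist_eq_zero this
  rw [← StateSpace.pullback_apply, this, StateSpace.pullback_apply]

/-- Weierstrass M-test: the terms are continuous and dominated by the geometric weights. Finiteness
of every `dₙ` allows the series to be computed in `ℝ`. -/
theorem IsInductiveSequence.continuous_limDist (μ : StateSpace (IndLim φ)) :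
    Continuous fun ν => limDist φ L μ ν := by
  let d (n : ℕ) (ν : StateSpace (IndLim φ)) : ℝ≥0∞ := mkDist (L n)
    (StateSpace.pullback (toLim φ n) μ) (StateSpace.pullback (toLim φ n) ν)
  have hd (n : ℕ) : Continuous (d n) := continuous_comp_uncurry
    (h.isLipNorm n).continuous_mkDist continuous_const (StateSpace.continuous_pullback _)
  have hd_top (n : ℕ) (ν) : d n ν ≠ ∞ := (h.isLipNorm n).mkDist_ne_top _ _
  have hterm (n : ℕ) (ν) : (2 ^ (n + 1))⁻¹ * (d n ν / (1 + d n ν)) ≠ ∞ :=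
    ((limDist_term_le n _).trans_lt (ENNReal.inv_lt_top.2 (by positivity))).ne
  have hreal (ν) : limDist φ L μ ν =
      ENNReal.ofReal (∑' n, ((2 ^ (n + 1))⁻¹ * ((d n ν).toReal / (1 + (d n ν).toReal)))) := by
    rw [← ENNReal.ofReal_toReal (limDist_ne_top φ L μ ν)]
    congr 1
    refine (ENNReal.tsum_toReal_eq fun n => hterm n ν).trans (tsum_congr fun n => ?_)
    rw [ENNReal.toReal_mul, ENNReal.toReal_div, ENNReal.toReal_add ENNReal.one_ne_top (hd_top n ν),
      ENNReal.toReal_inv, ENNReal.toReal_pow]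
    rfl
  simp_rw [hreal]
  refine ENNReal.continuous_ofReal.comp
    (continuous_tsum (u := fun n : ℕ => (1 / 2 : ℝ) ^ (n + 1)) (fun n => ?_) ?_ fun n ν => ?_)
  · have hc : Continuous fun ν => (d n ν).toReal :=
      ENNReal.continuousOn_toReal.comp_continuous (hd n) fun ν => hd_top n ν
    exact continuous_const.mul (hc.div₀ (continuous_const.add hc) fun ν =>
      (add_pos_of_pos_of_nonneg one_pos ENNReal.toReal_nonneg).ne')
  · exact (summable_nat_add_iff 1).2 summable_geometric_two
  · have h0 : 0 ≤ (d n ν).toReal := ENNReal.toReal_nonneg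
    rw [Real.norm_of_nonneg (by positivity), one_div, inv_pow]
    exact mul_le_of_le_one_right (by positivity)
      ((div_le_one (by positivity)).2 (le_add_of_nonneg_left zero_le_one))

/-- `limDist` is finite and separates states, so the quotient can be cleared off the diagonal; on
the diagonal both sides vanish. -/
theorem IsInductiveSequence.limLip_le_iff {a : IndLim φ} {c : ℝ≥0∞} :
    limLip φ L a ≤ c ↔ ∀ μ ν : StateSpace (IndLim φ), ‖μ.1 a - ν.1 a‖ₑ ≤ c * limDist φ L μ ν := by
  refine iSup₂_le_iff.trans (forall₂_congr fun μ ν => ?_)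
  rw [iSup_le_iff]
  constructor
  · intro hle
    rcases eq_or_ne μ ν with rfl | hne
    · simp
    · exact (ENNReal.div_le_iff (fun h0 => hne (h.eq_of_limDist_eq_zero h0))
        (limDist_ne_top φ L μ ν)).1 (hle hne)
  · exact fun hle hne => (ENNReal.div_le_iff (fun h0 => hne (h.eq_of_limDist_eq_zero h0))
        (limDist_ne_top φ L μ ν)).2 hle

theorem IsInductiveSequence.enorm_sub_le (a : IndLim φ) (μ ν : StateSpace (IndLim φ)) :
    ‖μ.1 a - ν.1 a‖ₑ ≤ limLip φ L a * limDist φ L μ ν :=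
  h.limLip_le_iff.1 le_rfl μ ν

theorem IsInductiveSequence.mkDist_limLip_le (μ ν : StateSpace (IndLim φ)) :
    mkDist (limLip φ L) μ ν ≤ limDist φ L μ ν :=
  iSup₂_le fun a ha => (h.enorm_sub_le a μ ν).trans (mul_le_of_le_one_left' ha)

theorem IsInductiveSequence.limLip_toLim_lt_top {n : ℕ} {a : A n} (ha : L n a < ∞) :
    limLip φ L (toLim φ n a) < ∞ := by
  obtain ⟨D, hD⟩ := (h.isLipNorm n).exists_mkDist_le
  -- The term `d / (1 + d)` recovers `d` up to the factor `1 + d ≤ 1 + D`, and `2 ^ (n + 1)` undoes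
  -- its weight.
  have hfin : L n a * ((1 + D) * 2 ^ (n + 1)) < ∞ := by finiteness
  refine lt_of_le_of_lt (h.limLip_le_iff.2 fun μ ν => ?_) hfin
  set d := mkDist (L n) (StateSpace.pullback (toLim φ n) μ) (StateSpace.pullback (toLim φ n) ν)
    with hd
  have hd_top : d ≠ ∞ := (h.isLipNorm n).mkDist_ne_top _ _
  have hterm : (2 ^ (n + 1))⁻¹ * (d / (1 + d)) ≤ limDist φ L μ ν := ENNReal.le_tsum n
  have hdle : d ≤ (1 + D) * 2 ^ (n + 1) * limDist φ L μ ν := by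
    calc d = (1 + d) * (2 ^ (n + 1) * ((2 ^ (n + 1))⁻¹ * (d / (1 + d)))) := by
          rw [← mul_assoc (2 ^ (n + 1)), ENNReal.mul_inv_cancel (by positivity) (by finiteness),
            one_mul, ENNReal.mul_div_cancel (by simp) (by finiteness)]
      _ ≤ (1 + D) * (2 ^ (n + 1) * limDist φ L μ ν) := by
          gcongr
          exact hD _ _
      _ = _ := (mul_assoc _ _ _).symm
  calc ‖μ.1 (toLim φ n a) - ν.1 (toLim φ n a)‖ₑ ≤ L n a * d :=
        (h.isLipNorm n).enorm_sub_le ha (StateSpace.pullback (toLim φ n) μ)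
          (StateSpace.pullback (toLim φ n) ν)
    _ ≤ L n a * ((1 + D) * 2 ^ (n + 1) * limDist φ L μ ν) := by gcongr
    _ = _ := (mul_assoc _ _ _).symm

theorem IsInductiveSequence.isLipschitzSeminorm_limLip :
    IsLipschitzSeminorm (limLip φ L) where
  add_le a b := h.limLip_le_iff.2 fun μ ν => by
    rw [map_add, map_add, add_sub_add_comm, add_mul]
    exact (enorm_add_le _ _).trans (add_le_add (h.enorm_sub_le a μ ν) (h.enorm_sub_le b μ ν))
  smul c a := by
    simp only [limLip, ENNReal.mul_iSup]
    refine iSup_congr fun μ => iSup_congr fun ν => iSup_congr fun _ => ?_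
    rw [map_smul, map_smul, ← smul_sub, enorm_smul, mul_div_assoc]
  star a := by
    refine iSup_congr fun μ => iSup_congr fun ν => iSup_congr fun _ => ?_
    rw [μ.apply_star, ν.apply_star, ← star_sub, Complex.star_def, RCLike.enorm_conj]
  eq_zero_iff a := by
    constructor
    · refine fun h0 => exists_eq_algebraMap_of_states fun μ ν => ?_
      have := h.enorm_sub_le a μ ν
      rwa [h0, zero_mul, nonpos_iff_eq_zero, enorm_eq_zero, sub_eq_zero] at this
    · rintro ⟨c, rfl⟩
      exact nonpos_iff_eq_zero.1 (h.limLip_le_iff.2 fun μ ν => by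
        simp [StateSpace.apply_algebraMap])
  dense := by
    -- The Lipschitz elements of `A n` are dense in `A n`, so the closure of the Lipschitz elements
    -- of the limit contains every range of `toLim φ n`.
    refine Dense.of_closure ((dense_iUnion_range_toLim φ).mono ?_)
    refine Set.iUnion_subset fun n => ?_
    rintro _ ⟨a, rfl⟩
    have hcont : Continuous (toLim φ n) :=
      AddMonoidHomClass.continuous_of_bound (toLim φ n) 1 fun a => by
        simpa using NonUnitalStarAlgHom.norm_apply_le (toLim φ n) a
    exact map_mem_closure hcont ((h.isLipNorm n).dense a) fun b hb => h.limLip_toLim_lt_top hb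

theorem IsInductiveSequence.isLipNorm_limLip : IsLipNorm (limLip φ L) := by
  refine h.isLipschitzSeminorm_limLip.isLipNorm fun μ => ?_
  have hlim : Tendsto (fun ν => limDist φ L μ ν) (𝓝 μ) (𝓝 0) := by
    have := (h.continuous_limDist μ).tendsto μ
    rwa [limDist_self] at this
  exact tendsto_of_tendsto_of_tendsto_of_le_of_le tendsto_const_nhds hlim (fun _ => zero_le)
    fun ν => h.mkDist_limLip_le μ ν

end Limit

/-! ### The universal property of the inductive limit -/

section UniversalProperty

variable {A : ℕ → Type u} [∀ n, CStarAlgebra (A n)] {φ : ∀ n, A n →⋆ₐ[ℂ] A (n + 1)}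
  {C : Type v} [CStarAlgebra C]

theorem IndLim.hom_ext {f g : IndLim φ →⋆ₐ[ℂ] C}
    (h : ∀ n, f.comp (toLim φ n) = g.comp (toLim φ n)) : f = g := by
  have hcont (k : IndLim φ →⋆ₐ[ℂ] C) : Continuous k :=
    AddMonoidHomClass.continuous_of_bound k 1 fun a => by
      simpa using NonUnitalStarAlgHom.norm_apply_le k a
  refine DFunLike.coe_injective
    (Continuous.ext_on (dense_iUnion_range_toLim φ) (hcont f) (hcont g) fun a ha => ?_)
  obtain ⟨n, b, rfl⟩ := Set.mem_iUnion.1 ha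
  exact DFunLike.congr_fun (h n) b

/-- The eventual value of `F n (x n)` for an eventually coherent sequence `x` and a compatible
family of ⋆-homomorphisms `F n`. -/
noncomputable def PreLim.lift (F : ∀ n, A n →⋆ₐ[ℂ] C) (x : PreLim φ) : C :=
  limUnder atTop fun n => F n (PreLim.val φ x n)

theorem PreLim.lift_eq {F : ∀ n, A n →⋆ₐ[ℂ] C} {x : PreLim φ} {c : C}
    (h : ∀ᶠ n in atTop, F n (PreLim.val φ x n) = c) : PreLim.lift F x = c :=
  (tendsto_const_nhds.congr' (h.mono fun _ hn => hn.symm)).limUnder_eq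

variable {F : ∀ n, A n →⋆ₐ[ℂ] C} (hF : ∀ n a, F (n + 1) (φ n a) = F n a)

include hF

/-- Compatibility of the `F n` makes the sequence constant once `x` is coherent, so the limit is a
value actually attained. Algebraic identities can then be checked at a single late index. -/
theorem PreLim.eventually_eq_lift (x : PreLim φ) :
    ∀ᶠ n in atTop, F n (PreLim.val φ x n) = PreLim.lift F x := by
  obtain ⟨N, hN⟩ := eventually_atTop.1 x.2
  have hconst : ∀ n ≥ N, F n (PreLim.val φ x n) = F N (PreLim.val φ x N) := by
    intro n hn
    induction n, hn using Nat.le_induction with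
    | base => rfl
    | succ n hn ih => exact (congrArg (F (n + 1)) (hN n hn)).trans ((hF n _).trans ih)
  have := eventually_atTop.2 ⟨N, hconst⟩
  rwa [PreLim.lift_eq this]

/-- Each `F n` is contractive, so the eventual value is bounded by `‖x n‖` for large `n`, hence by
the limit seminorm. This is what lets the lift pass to the completion. -/
theorem PreLim.norm_lift_le (x : PreLim φ) : ‖PreLim.lift F x‖ ≤ ‖x‖ := by
  refine ge_of_tendsto (PreLim.tendsto_norm φ x) ?_
  filter_upwards [PreLim.eventually_eq_lift hF x] with n hn
  rw [← hn]
  exact NonUnitalStarAlgHom.norm_apply_le _ _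

theorem PreLim.lift_add (x y : PreLim φ) :
    PreLim.lift F (x + y) = PreLim.lift F x + PreLim.lift F y := by
  refine PreLim.lift_eq ?_
  filter_upwards [PreLim.eventually_eq_lift hF x, PreLim.eventually_eq_lift hF y] with n hx hy
  rw [map_add, Pi.add_apply, map_add, hx, hy]

theorem PreLim.lift_mul (x y : PreLim φ) :
    PreLim.lift F (x * y) = PreLim.lift F x * PreLim.lift F y := by
  refine PreLim.lift_eq ?_
  filter_upwards [PreLim.eventually_eq_lift hF x, PreLim.eventually_eq_lift hF y] with n hx hy
  rw [map_mul, Pi.mul_apply, map_mul, hx, hy]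

theorem PreLim.lift_star (x : PreLim φ) : PreLim.lift F (star x) = star (PreLim.lift F x) := by
  refine PreLim.lift_eq ?_
  filter_upwards [PreLim.eventually_eq_lift hF x] with n hx
  rw [map_star, Pi.star_apply, map_star, hx]

omit hF in
theorem PreLim.lift_algebraMap (c : ℂ) :
    PreLim.lift F (algebraMap ℂ (PreLim φ) c) = algebraMap ℂ C c := by
  refine PreLim.lift_eq (Eventually.of_forall fun n => ?_)
  rw [AlgHomClass.commutes, Pi.algebraMap_apply, AlgHomClass.commutes]

theorem PreLim.uniformContinuous_lift : UniformContinuous (PreLim.lift F : PreLim φ → C) := by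
  let f : PreLim φ →+ C := AddMonoidHom.mk' (PreLim.lift F) (PreLim.lift_add hF)
  exact AddMonoidHomClass.uniformContinuous_of_bound f 1 fun x => by
    rw [one_mul]
    exact PreLim.norm_lift_le hF x

/-- The universal property of the inductive limit: a compatible family of ⋆-homomorphisms
extends to the limit. -/
theorem IndLim.exists_lift : ∃ f : IndLim φ →⋆ₐ[ℂ] C, ∀ n, f.comp (toLim φ n) = F n := by
  let f : IndLim φ → C := UniformSpace.Completion.extension (PreLim.lift F : PreLim φ → C)
  have hf : Continuous f := UniformSpace.Completion.continuous_extension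
  have hmk (x : PreLim φ) : f (IndLim.mk φ x) = PreLim.lift F x :=
    UniformSpace.Completion.extension_coe (PreLim.uniformContinuous_lift hF) x
  have halg (c : ℂ) : f (algebraMap ℂ _ c) = algebraMap ℂ C c := by
    rw [← IndLim.mk_algebraMap, hmk, PreLim.lift_algebraMap]
  refine ⟨
    { toFun := f
      map_one' := by simpa using halg 1
      map_zero' := by simpa using halg 0
      map_mul' := IndLim.ind₂ φ (isClosed_eq (hf.comp (continuous_fst.mul continuous_snd))
          ((hf.comp continuous_fst).mul (hf.comp continuous_snd))) fun x y => by
        rw [← IndLim.mk_mul, hmk, hmk, hmk, PreLim.lift_mul hF]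
      map_add' := IndLim.ind₂ φ (isClosed_eq (hf.comp (continuous_fst.add continuous_snd))
          ((hf.comp continuous_fst).add (hf.comp continuous_snd))) fun x y => by
        rw [← IndLim.mk_add, hmk, hmk, hmk, PreLim.lift_add hF]
      commutes' := halg
      map_star' := IndLim.ind φ (isClosed_eq (hf.comp (IndLim.continuous_star φ))
          hf.star) fun x => by
        rw [← IndLim.mk_star, hmk, hmk, PreLim.lift_star hF] }, fun n => ?_⟩
  refine StarAlgHom.ext fun a => (hmk _).trans (PreLim.lift_eq ?_)
  filter_upwards [eventually_ge_atTop n] with k hk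
  rw [PreLim.val_single φ hk]
  induction k, hk using Nat.le_induction with
  | base => rw [conn_self]
  | succ k hk ih => rw [conn_succ φ hk, hF, ih]

end UniversalProperty

/-! ### Lipschitz estimates for homomorphisms between limits -/

section Comparison

variable {A : ℕ → Type u} [∀ n, CStarAlgebra (A n)] {φ : ∀ n, A n →⋆ₐ[ℂ] A (n + 1)}
  {LA : ∀ n, A n → ℝ≥0∞} {B : ℕ → Type v} [∀ n, CStarAlgebra (B n)]
  {φ' : ∀ n, B n →⋆ₐ[ℂ] B (n + 1)} {LB : ∀ n, B n → ℝ≥0∞}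

/-- Every `dₙ` of the pulled-back states is at most `c` times the target distance; dropping the
denominators, the weighted average of these bounds is the same bound. -/
theorem limDist_pullback_le (hB : IsInductiveSequence φ' LB) (f : IndLim φ →⋆ₐ[ℂ] IndLim φ')
    {c : ℝ≥0∞} (hc : ∀ n a, limLip φ' LB (f (toLim φ n a)) ≤ c * LA n a)
    (μ ν : StateSpace (IndLim φ')) :
    limDist φ LA (StateSpace.pullback f μ) (StateSpace.pullback f ν) ≤ c * limDist φ' LB μ ν := by
  have hd (n : ℕ) : mkDist (LA n) (StateSpace.pullback (toLim φ n) (StateSpace.pullback f μ))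
      (StateSpace.pullback (toLim φ n) (StateSpace.pullback f ν)) ≤ c * limDist φ' LB μ ν := by
    refine iSup₂_le fun a ha => (hB.enorm_sub_le (f (toLim φ n a)) μ ν).trans ?_
    gcongr
    exact (hc n a).trans (mul_le_of_le_one_right' ha)
  calc limDist φ LA (StateSpace.pullback f μ) (StateSpace.pullback f ν)
      ≤ ∑' n : ℕ, (2 ^ (n + 1))⁻¹ * (c * limDist φ' LB μ ν) := by
        refine ENNReal.tsum_le_tsum fun n => ?_
        gcongr
        exact (ENNReal.div_le_of_le_mul (le_mul_of_one_le_right' le_self_add)).trans (hd n)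
    _ = c * limDist φ' LB μ ν := by
        rw [ENNReal.tsum_mul_right, tsum_inv_two_pow_succ, one_mul]

/-- A ⋆-homomorphism between inductive limits is Lipschitz if its restrictions to the terms of the
first sequence are Lipschitz with a common constant. -/
theorem limLip_apply_le (hA : IsInductiveSequence φ LA) (hB : IsInductiveSequence φ' LB)
    (f : IndLim φ →⋆ₐ[ℂ] IndLim φ') {c : ℝ≥0∞}
    (hc : ∀ n a, limLip φ' LB (f (toLim φ n a)) ≤ c * LA n a) (a : IndLim φ) :
    limLip φ' LB (f a) ≤ c * limLip φ LA a := by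
  refine hB.limLip_le_iff.2 fun μ ν => ?_
  calc ‖μ.1 (f a) - ν.1 (f a)‖ₑ
      ≤ limLip φ LA a * limDist φ LA (StateSpace.pullback f μ) (StateSpace.pullback f ν) :=
        hA.enorm_sub_le a (StateSpace.pullback f μ) (StateSpace.pullback f ν)
    _ ≤ limLip φ LA a * (c * limDist φ' LB μ ν) := by
        gcongr
        exact limDist_pullback_le hB f hc μ ν
    _ = c * limLip φ LA a * limDist φ' LB μ ν := by ring

theorem limLip_apply_le_iSup (hA : IsInductiveSequence φ LA) (hB : IsInductiveSequence φ' LB)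
    (f : IndLim φ →⋆ₐ[ℂ] IndLim φ') {l : ℕ → ℝ≥0} (hl : BddAbove (Set.range l))
    (hc : ∀ n a, limLip φ' LB (f (toLim φ n a)) ≤ l n * LA n a) (a : IndLim φ) :
    limLip φ' LB (f a) ≤ 2 * (⨆ n, l n : ℝ≥0) * limLip φ LA a := by
  refine (limLip_apply_le hA hB f (c := (⨆ n, l n : ℝ≥0)) (fun n a => ?_) a).trans ?_
  · refine (hc n a).trans ?_
    gcongr
    exact le_ciSup hl n
  · gcongr
    exact le_mul_of_one_le_left' one_le_two

end Comparison

end QMS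

/-! ### The intertwining theorem -/

theorem theorem4p7 {A B : ℕ → Type*} [∀ n, CStarAlgebra (A n)] [∀ n, CStarAlgebra (B n)]
    (φ : ∀ n, A n →⋆ₐ[ℂ] A (n + 1)) (LA : ∀ n, A n → ℝ≥0∞)
    (φ' : ∀ n, B n →⋆ₐ[ℂ] B (n + 1)) (LB : ∀ n, B n → ℝ≥0∞)
    (hA : QMS.IsInductiveSequence φ LA) (hB : QMS.IsInductiveSequence φ' LB)
    (ψ : ∀ n, A n →⋆ₐ[ℂ] B n) (Ψ : ∀ n, B n →⋆ₐ[ℂ] A (n + 1))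
    (hφ : ∀ n, (Ψ n).comp (ψ n) = φ n) (hφ' : ∀ n, (ψ (n + 1)).comp (Ψ n) = φ' n)
    (lam gam : ℕ → ℝ≥0) (hlam : BddAbove (Set.range lam)) (hgam : BddAbove (Set.range gam))
    (hψ : ∀ n a, QMS.limLip φ' LB (QMS.toLim φ' n (ψ n a)) ≤ lam n * LA n a)
    (hΨ : ∀ n b, QMS.limLip φ LA (QMS.toLim φ (n + 1) (Ψ n b)) ≤ gam n * LB n b) :
    (∃ (f : QMS.IndLim φ →⋆ₐ[ℂ] QMS.IndLim φ') (g : QMS.IndLim φ' →⋆ₐ[ℂ] QMS.IndLim φ),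
      (f.comp g = StarAlgHom.id ℂ (QMS.IndLim φ') ∧
        g.comp f = StarAlgHom.id ℂ (QMS.IndLim φ)) ∧
      (∀ n, f.comp (QMS.toLim φ n) = (QMS.toLim φ' n).comp (ψ n) ∧
        g.comp (QMS.toLim φ' n) = (QMS.toLim φ (n + 1)).comp (Ψ n) ∧
        ((QMS.toLim φ (n + 1)).comp (Ψ n)).comp (ψ n) = QMS.toLim φ n ∧
        f.comp ((QMS.toLim φ (n + 1)).comp (Ψ n)) = QMS.toLim φ' n) ∧
      (∀ a, QMS.limLip φ' LB (f a) ≤ 2 * (⨆ n, lam n : ℝ≥0) * QMS.limLip φ LA a) ∧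
      (∀ b, QMS.limLip φ LA (g b) ≤ 2 * (⨆ n, gam n : ℝ≥0) * QMS.limLip φ' LB b) ∧
      (∀ f' : QMS.IndLim φ →⋆ₐ[ℂ] QMS.IndLim φ',
        (∀ n, f'.comp (QMS.toLim φ n) = (QMS.toLim φ' n).comp (ψ n)) → f' = f) ∧
      (∀ g' : QMS.IndLim φ' →⋆ₐ[ℂ] QMS.IndLim φ,
        (∀ n, g'.comp (QMS.toLim φ' n) = (QMS.toLim φ (n + 1)).comp (Ψ n)) → g' = g)) ∧
    QMS.LipschitzIsomorphic (QMS.limLip φ LA) (QMS.limLip φ' LB) := by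
  obtain ⟨f, hf⟩ := QMS.IndLim.exists_lift (φ := φ) (F := fun n => (QMS.toLim φ' n).comp (ψ n))
    fun n a => by
      simp only [StarAlgHom.comp_apply]
      -- Both sides pass through `B (n + 1)`, where `ψ (n + 1) ∘ φ n = ψ (n + 1) ∘ Ψ n ∘ ψ n = φ' n
      -- ∘ ψ n`.
      rw [← QMS.toLim_succ φ' n (ψ n a), ← hφ n, ← hφ' n]
      rfl
  obtain ⟨g, hg⟩ := QMS.IndLim.exists_lift (φ := φ')
    (F := fun n => (QMS.toLim φ (n + 1)).comp (Ψ n)) fun n b => by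
      simp only [StarAlgHom.comp_apply]
      -- `Ψ n` lands in `A (n + 1)`, so the comparison takes place in `A (n + 2)`, with both maps
      -- equal to `Ψ (n + 1) ∘ ψ (n + 1) ∘ Ψ n`.
      rw [← QMS.toLim_succ φ (n + 1) (Ψ n b), ← hφ (n + 1), ← hφ' n]
      rfl
  have hA_comp (n : ℕ) : ((QMS.toLim φ (n + 1)).comp (Ψ n)).comp (ψ n) = QMS.toLim φ n := by
    rw [StarAlgHom.comp_assoc, hφ n]
    exact StarAlgHom.ext fun a => QMS.toLim_succ φ n a
  have hB_comp (n : ℕ) : f.comp ((QMS.toLim φ (n + 1)).comp (Ψ n)) = QMS.toLim φ' n := by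
    rw [← StarAlgHom.comp_assoc, hf, StarAlgHom.comp_assoc, hφ' n]
    exact StarAlgHom.ext fun b => QMS.toLim_succ φ' n b
  have hfg : f.comp g = StarAlgHom.id ℂ (QMS.IndLim φ') := QMS.IndLim.hom_ext fun n => by
    rw [StarAlgHom.comp_assoc, hg, hB_comp, StarAlgHom.id_comp]
  have hgf : g.comp f = StarAlgHom.id ℂ (QMS.IndLim φ) := QMS.IndLim.hom_ext fun n => by
    rw [StarAlgHom.comp_assoc, hf, ← StarAlgHom.comp_assoc, hg, hA_comp, StarAlgHom.id_comp]
  have hLf := QMS.limLip_apply_le_iSup hA hB f hlam fun n a => by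
    rw [← StarAlgHom.comp_apply f, hf]
    exact hψ n a
  have hLg := QMS.limLip_apply_le_iSup hB hA g hgam fun n b => by
    rw [← StarAlgHom.comp_apply g, hg]
    exact hΨ n b
  refine ⟨⟨f, g, ⟨hfg, hgf⟩, fun n => ⟨hf n, hg n, hA_comp n, hB_comp n⟩, hLf, hLg,
    fun f' hf' => QMS.IndLim.hom_ext fun n => (hf' n).trans (hf n).symm,
    fun g' hg' => QMS.IndLim.hom_ext fun n => (hg' n).trans (hg n).symm⟩,
    hA.isLipNorm_limLip, hB.isLipNorm_limLip,
    -- Adding `1` keeps the constants strictly positive even when a supremum is zero.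
    StarAlgEquiv.ofStarAlgHom f g hgf hfg, 2 * (⨆ n, lam n) + 1, 2 * (⨆ n, gam n) + 1,
    by positivity, by positivity, fun a => (hLf a).trans ?_, fun b => (hLg b).trans ?_⟩
  · gcongr
    push_cast
    exact le_self_add
  · gcongr
    push_cast
    exact le_self_add
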